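/- **Setting.** Let $\mathcal S,\mathcal A$ be finite nonempty sets, $\gamma\in(0,1)$, and let $\phi:\mathcal S\times\mathcal A\to\mathbb R^d$ be a feature map with $\|\phi(s,a)\|\le 1$ for all $(s,a)$, whose values span $\mathbb R^d$. Let $\nu$ be a measure on $\mathbb R$ supported in $[0,1]$. An MDP $\mathcal M$ consists of transition probabilities $p_{\mathcal M}(s,a,\cdot)$ on $\mathcal S$ and reward distributions $q_{\mathcal M}(s,a,\cdot)\ll\nu$ with means $r_{\mathcal M}(s,a)$. It is linear if there are $\theta_{\mathcal M}\in\mathbb R^d$ and $\mu_{\mathcal M}:\mathcal S\to\mathbb R^d$ with $p_{\mathcal M}(s,a,s')=\phi(s,a)^\top\mu_{\mathcal M}(s')$, $r_{\mathcal M}(s,a)=\phi(s,a)^\top\theta_{\mathcal M}$, $\|\theta_{\mathcal M}\|\le\sqrt d$ and $\big\|\sum_{s}|\mu_{\mathcal M}(s)|\big\|\le\sqrt d$ (with $|\cdot|$ taken coordinatewise). A policy is a map $\pi:\mathcal S\to\mathcal A$, and its value is $V^\pi_{\mathcal M}(s)=\mathbb E_{\mathcal M}\big[\sum_{t\ge 0}\gamma^t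 r_{\mathcal M}(s_t,\pi(s_t))\,\big|\,s_0=s\big]$, where $s_{t+1}\sim p_{\mathcal M}(s_t,\pi(s_t),\cdot)$. A policy is optimal if it maximizes the value at every state. $\mathbb M$ denotes the set of linear MDPs (for these $\phi,\nu,\gamma$) whose optimal policy is unique; the value function of the optimal policy is written $V^\star_{\mathcal M}$. For $\varepsilon\ge 0$, let $\Pi^\star_\varepsilon(\mathcal M)=\{\pi: V^\pi_{\mathcal M}(s)\ge V^\star_{\mathcal M}(s)-\varepsilon\ \text{for all } s\}$. **Algorithms.** A learning algorithm (generative model) has internal randomness drawn beforehand, a sampling rule, a stopping rule and a decision rule, none depending on $\mathcal M$. In each round the sampling rule selects, possibly at random, a pair $(s,a)$ from the internal randomness and the past observations; the learner then observes a reward from $q_{\mathcal M}(s,a,\cdot)$ and, independently, a next state from $p_{\mathcal M}(s,a,\cdot)$. The number $\tau\in\{0,1,\dots\}\cup\{\infty\}$ of samples is a stopping time of the filtration generated by the internal randomness and the observations, and the output policy $\hat\pi$ is measurable with respect to the information available at $\tau$. The algorithm is $(\delta,\varepsilon)$-PAC if $\mathbb P_{\mathcal M}\big[\tau<\infty,\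 \hat\pi\in\Pi^\star_\varepsilon(\mathcal M)\big]\ge 1-\delta$ for every $\mathcal M\in\mathbb M$. **Divergences.** Write $\mathcal M\ll\mathcal M'$ if $p_{\mathcal M}(s,a,\cdot)\ll p_{\mathcal M'}(s,a,\cdot)$ and $q_{\mathcal M}(s,a,\cdot)\ll q_{\mathcal M'}(s,a,\cdot)$ for all $(s,a)$, and in that case put $$\mathrm{KL}_{\mathcal M|\mathcal M'}(s,a)=\mathrm{KL}\big(q_{\mathcal M}(s,a,\cdot)\,\|\,q_{\mathcal M'}(s,a,\cdot)\big)+\mathrm{KL}\big(p_{\mathcal M}(s,a,\cdot)\,\|\,p_{\mathcal M'}(s,a,\cdot)\big)\in[0,\infty].$$ Let $\mathrm{Alt}_\varepsilon(\mathcal M)=\{\mathcal M'\in\mathbb M:\ \mathcal M\ll\mathcal M',\ \Pi^\star_\varepsilon(\mathcal M)\cap\Pi^\star_\varepsilon(\mathcal M')=\emptyset\}$, let $\mathrm{kl}(a,b)$ be the Kullback–Leibler divergence of the Bernoulli laws with means $a$ and $b$, and let $\Sigma_{\mathcal S\times\mathcal A}$ be the simplex of probability vectors on $\mathcal S\times\mathcal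 A$. **Proposition.** Let $\varepsilon\in[0,1)$ and $\delta\in(0,1/2]$. For every $(\delta,\varepsilon)$-PAC algorithm and every $\mathcal M\in\mathbb M$, $$\mathbb E_{\mathcal M}[\tau]\ \ge\ T^\star(\mathcal M)\,\mathrm{kl}(\delta,1-\delta),\qquad T^\star(\mathcal M)^{-1}=\sup_{\omega\in\Sigma_{\mathcal S\times\mathcal A}}\ \inf_{\mathcal M'\in\mathrm{Alt}_\varepsilon(\mathcal M)}\ \sum_{(s,a)}\omega_{s,a}\,\mathrm{KL}_{\mathcal M|\mathcal M'}(s,a),$$ where all quantities are in $[0,\infty]$, with the conventions $\inf\emptyset=\infty$, $1/\infty=0$, $1/0=\infty$, $0\cdot\infty=0$. -/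

import Mathlib

open MeasureTheory ProbabilityTheory
open scoped ENNReal

universe u

namespace LinMDP

/-- A Markov decision process on the state space `S` and the action space `A`: the law
`trans s a` of the next state and the law `rew s a` of the random reward when the action `a`
is selected in the state `s`. -/
structure MDP (S A : Type u) [MeasurableSpace S] where
  trans : S → A → Measure S
  rew : S → A → Measure ℝ
  isProb_trans : ∀ s a, IsProbabilityMeasure (trans s a)
  isProb_rew : ∀ s a, IsProbabilityMeasure (rew s a)

attribute [instance] MDP.isProb_trans MDP.isProb_rew

/-- A (stationary deterministic) control policy. -/
abbrev Policy (S A : Type u) := S → A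

namespace MDP

variable {S A : Type u} [MeasurableSpace S]

/-- The expected reward `r(s, a)`. -/
noncomputable def meanReward (M : MDP S A) (s : S) (a : A) : ℝ := ∫ x, x ∂(M.rew s a)

/-- Transition kernel of the Markov chain of the states under the policy `π`. -/
noncomputable def policyKernel [DiscreteMeasurableSpace S] (M : MDP S A) (π : Policy S A) :
    Kernel S S where
  toFun s := M.trans s (π s)
  measurable' := Measurable.of_discrete

instance [DiscreteMeasurableSpace S] (M : MDP S A) (π : Policy S A) :
    IsMarkovKernel (M.policyKernel π) :=
  ⟨fun s => M.isProb_trans s (π s)⟩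

/-- Law of the sequence of states `(s_0, s_1, …)` under the policy `π`, started at `s_0 = s`. -/
noncomputable def stateLaw [DiscreteMeasurableSpace S] (M : MDP S A) (π : Policy S A) (s : S) :
    Measure (ℕ → S) :=
  Kernel.trajMeasure (X := fun _ => S) (Measure.dirac s)
    (fun n => (M.policyKernel π).comap
      (fun h : (i : Finset.Iic n) → S => h ⟨n, Finset.mem_Iic.2 le_rfl⟩)
      (measurable_pi_apply _))

/-- The state value function `V^π(s) = 𝔼[∑ₜ γᵗ r(s_t, π(s_t)) | s_0 = s]`. -/
noncomputable def value [DiscreteMeasurableSpace S] (γ : ℝ) (M : MDP S A) (π : Policy S A)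
    (s : S) : ℝ :=
  ∫ x, ∑' t : ℕ, γ ^ t * M.meanReward (x t) (π (x t)) ∂(M.stateLaw π s)

/-- `π` is optimal: it maximizes the value function at every state. -/
def IsOptimal [DiscreteMeasurableSpace S] (γ : ℝ) (M : MDP S A) (π : Policy S A) : Prop :=
  ∀ π' : Policy S A, ∀ s, M.value γ π' s ≤ M.value γ π s

/-- The optimal value function `V^⋆`. -/
noncomputable def optValue [DiscreteMeasurableSpace S] (γ : ℝ) (M : MDP S A) (s : S) : ℝ :=
  ⨆ π : Policy S A, M.value γ π s

/-- `V^⋆` is the value function of any optimal policy. -/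
theorem optValue_eq_of_isOptimal [DiscreteMeasurableSpace S] [Finite S] [Finite A] {γ : ℝ}
    {M : MDP S A} {π : Policy S A} (h : M.IsOptimal γ π) (s : S) :
    M.optValue γ s = M.value γ π s := by
  have : Nonempty (Policy S A) := ⟨π⟩
  exact le_antisymm (ciSup_le fun π' => h π' s)
    (le_ciSup (f := fun π' : Policy S A => M.value γ π' s) (Set.finite_range _).bddAbove π)

/-- The set `Π_ε^⋆(M)` of `ε`-optimal policies. -/
def epsOptimal [DiscreteMeasurableSpace S] (γ ε : ℝ) (M : MDP S A) : Set (Policy S A) :=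
  {π | ∀ s, M.optValue γ s - ε ≤ M.value γ π s}

/-- `M` is a linear MDP for the feature map `φ`, with reward distributions dominated by `ν`. -/
def IsLinear [Fintype S] {d : ℕ} (φ : S → A → EuclideanSpace ℝ (Fin d)) (ν : Measure ℝ)
    (M : MDP S A) : Prop :=
  (∀ s a, M.rew s a ≪ ν) ∧
  (∃ μ : S → EuclideanSpace ℝ (Fin d),
    (∀ s a s', (M.trans s a).real {s'} = inner ℝ (φ s a) (μ s')) ∧
    ‖∑ s, WithLp.toLp 2 (fun i => |μ s i|)‖ ≤ √(d : ℝ)) ∧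
  (∃ θ : EuclideanSpace ℝ (Fin d),
    (∀ s a, M.meanReward s a = inner ℝ (φ s a) θ) ∧ ‖θ‖ ≤ √(d : ℝ))

/-- `M ≪ M'`: all transition and reward distributions of `M` are absolutely continuous with
respect to those of `M'`. -/
def AbsCont (M M' : MDP S A) : Prop :=
  ∀ s a, M.trans s a ≪ M'.trans s a ∧ M.rew s a ≪ M'.rew s a

/-- The divergence `KL_{M|M'}(s, a)`. -/
noncomputable def klMDP (M M' : MDP S A) (s : S) (a : A) : ℝ≥0∞ :=
  InformationTheory.klDiv (M.rew s a) (M'.rew s a) +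
    InformationTheory.klDiv (M.trans s a) (M'.trans s a)

/-- What the generative model returns when the pair `(s, a)` is sampled: a reward and a next
state, drawn independently from `rew s a` and `trans s a`. -/
noncomputable def response [DiscreteMeasurableSpace S] [Countable S] [Countable A]
    [MeasurableSpace A] [DiscreteMeasurableSpace A] (M : MDP S A) : Kernel (S × A) (ℝ × S) where
  toFun z := (M.rew z.1 z.2).prod (M.trans z.1 z.2)
  measurable' := Measurable.of_discrete

instance [DiscreteMeasurableSpace S] [Countable S] [Countable A]
    [MeasurableSpace A] [DiscreteMeasurableSpace A] (M : MDP S A) : IsMarkovKernel M.response :=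
  ⟨fun z => inferInstanceAs (IsProbabilityMeasure ((M.rew z.1 z.2).prod (M.trans z.1 z.2)))⟩

end MDP

/-- The class `𝕄` of linear MDPs (for the given features, dominating measure and discount factor),
each having a unique optimal policy. -/
def linearMDPs {S A : Type u} [Fintype S] [MeasurableSpace S] [DiscreteMeasurableSpace S]
    {d : ℕ} (φ : S → A → EuclideanSpace ℝ (Fin d)) (ν : Measure ℝ) (γ : ℝ) : Set (MDP S A) :=
  {M | M.IsLinear φ ν ∧ ∃! π : Policy S A, M.IsOptimal γ π}

/-- The set `Alt_ε(M)` of alternative MDPs. -/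
def altMDPs {S A : Type u} [Fintype S] [MeasurableSpace S] [DiscreteMeasurableSpace S]
    {d : ℕ} (φ : S → A → EuclideanSpace ℝ (Fin d)) (ν : Measure ℝ) (γ ε : ℝ) (M : MDP S A) :
    Set (MDP S A) :=
  {M' | M' ∈ linearMDPs φ ν γ ∧ M.AbsCont M' ∧ M.epsOptimal γ ε ∩ M'.epsOptimal γ ε = ∅}

/-- `T(M, ω)⁻¹`, the infimum over `Alt_ε(M)` (`∞` if this set is empty) of
`∑_{s,a} ω_{s,a} KL_{M|M'}(s, a)`. -/
noncomputable def invTime {S A : Type u} [Fintype S] [Fintype A] [MeasurableSpace S]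
    [DiscreteMeasurableSpace S] {d : ℕ} (φ : S → A → EuclideanSpace ℝ (Fin d)) (ν : Measure ℝ)
    (γ ε : ℝ) (M : MDP S A) (ω : S × A → ℝ) : ℝ≥0∞ :=
  ⨅ M' ∈ altMDPs φ ν γ ε M, ∑ z : S × A, ENNReal.ofReal (ω z) * M.klMDP M' z.1 z.2

/-- The characteristic time `T^⋆(M)`, with `1/0 = ∞` and `1/∞ = 0`. -/
noncomputable def charTime {S A : Type u} [Fintype S] [Fintype A] [MeasurableSpace S]
    [DiscreteMeasurableSpace S] {d : ℕ} (φ : S → A → EuclideanSpace ℝ (Fin d)) (ν : Measure ℝ)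
    (γ ε : ℝ) (M : MDP S A) : ℝ≥0∞ :=
  (⨆ ω ∈ stdSimplex ℝ (S × A), invTime φ ν γ ε M ω)⁻¹

/-- The Bernoulli law with mean `a`, for `a ∈ [0, 1]` (`a` is projected onto `[0, 1]`). -/
noncomputable def bernoulliLaw (a : ℝ) : Measure Bool :=
  bernoulliMeasure true false (Set.projIcc (0 : ℝ) 1 zero_le_one a)

/-- `kl(a, b)`: divergence of the Bernoulli laws with means `a` and `b`. -/
noncomputable def kl (a b : ℝ) : ℝ≥0∞ :=
  InformationTheory.klDiv (bernoulliLaw a) (bernoulliLaw b)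

section Algorithm

/-- One observation of the learner: the sampled pair, then the reward and the next state. -/
abbrev Obs (S A : Type u) := (S × A) × (ℝ × S)

/-- The coordinates of a run: coordinate `0` is the internal randomness of the learner,
coordinate `n + 1` is its `(n + 1)`-st observation. -/
abbrev Coord (S A U : Type u) : ℕ → Type u
  | 0 => U
  | _ + 1 => Obs S A

instance Coord.instMeasurableSpace {S A U : Type u} [MeasurableSpace S] [MeasurableSpace A]
    [MeasurableSpace U] : ∀ n, MeasurableSpace (Coord S A U n)
  | 0 => inferInstanceAs (MeasurableSpace U)
  | _ + 1 => inferInstanceAs (MeasurableSpace (Obs S A))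

variable (S A U : Type u) [MeasurableSpace S] [MeasurableSpace A] [MeasurableSpace U]

/-- A run of the learner. -/
abbrev Run := (n : ℕ) → Coord S A U n

/-- What the learner knows after `n` samples: its internal randomness and `n` observations. -/
abbrev History (n : ℕ) := (i : Finset.Iic n) → Coord S A U i

/-- The filtration generated by the run: time `n` is the time when `n` samples were taken. -/
abbrev runFiltration : Filtration ℕ (MeasurableSpace.pi : MeasurableSpace (Run S A U)) :=
  Filtration.piLE (X := Coord S A U)

/-- A learning algorithm (generative model). None of its components depends on the MDP.
Before the first sample, it draws internal randomness in `U` with the law `seed`. The sampling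
rule selects the next pair, possibly at random, from what was seen so far; a learner that has to
follow the trajectory of the system is the case in which the selected state is always the last
observed one. The stopping rule is a stopping time `τ`, possibly infinite, which counts the samples;
the decision rule outputs a policy that is determined by what was seen up to `τ`. -/
structure Algorithm where
  seed : Measure U
  isProb_seed : IsProbabilityMeasure seed
  sample : (n : ℕ) → Kernel (History S A U n) (S × A)
  isMarkov_sample : ∀ n, IsMarkovKernel (sample n)
  τ : Run S A U → ℕ∞
  isStoppingTime_τ : IsStoppingTime (runFiltration S A U) τ
  decision : Run S A U → Policy S A
  measurable_decision : Measurable[isStoppingTime_τ.measurableSpace] decision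

attribute [instance] Algorithm.isProb_seed Algorithm.isMarkov_sample

variable {S A U} [Countable S] [Countable A] [DiscreteMeasurableSpace S]
  [DiscreteMeasurableSpace A]

namespace Algorithm

/-- Conditional law of the next observation, given the history, when the MDP is `M`. -/
noncomputable def step (alg : Algorithm S A U) (M : MDP S A) (n : ℕ) :
    Kernel (History S A U n) (Coord S A U (n + 1)) :=
  (alg.sample n) ⊗ₖ (Kernel.prodMkLeft (History S A U n) M.response)

instance (alg : Algorithm S A U) (M : MDP S A) (n : ℕ) : IsMarkovKernel (alg.step M n) :=
  inferInstanceAs (IsMarkovKernel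
    ((alg.sample n) ⊗ₖ (Kernel.prodMkLeft (History S A U n) M.response)))

/-- The law `ℙ_M` of the run when the MDP is `M`. -/
noncomputable def law (alg : Algorithm S A U) (M : MDP S A) : Measure (Run S A U) :=
  Kernel.trajMeasure (X := Coord S A U) alg.seed (alg.step M)

/-- The algorithm is `(δ, ε)`-PAC: whatever the linear MDP is, with probability at least `1 - δ`
it stops and outputs an `ε`-optimal policy. -/
def IsPAC {S A U : Type u} [Fintype S] [Fintype A] [MeasurableSpace S] [MeasurableSpace A]
    [MeasurableSpace U] [DiscreteMeasurableSpace S] [DiscreteMeasurableSpace A] {d : ℕ}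
    (alg : Algorithm S A U) (φ : S → A → EuclideanSpace ℝ (Fin d)) (ν : Measure ℝ)
    (γ ε δ : ℝ) : Prop :=
  ∀ M ∈ linearMDPs φ ν γ, ENNReal.ofReal (1 - δ) ≤
    alg.law M {x | alg.τ x < ⊤ ∧ alg.decision x ∈ M.epsOptimal γ ε}

/-- The expected sample complexity `𝔼_M[τ]`. -/
noncomputable def expectedTime (alg : Algorithm S A U) (M : MDP S A) : ℝ≥0∞ :=
  ∫⁻ x, (alg.τ x : ℝ≥0∞) ∂(alg.law M)

end Algorithm

end Algorithm

end LinMDP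

open LinMDP

/-! The engine is a change of measure. Fix `M'` in the alternative set and let `E` be the event that
the algorithm stops with a policy that is ε-optimal for `M`. No policy is ε-optimal for both MDPs,
so `E` has probability at least `1 - δ` under `M` and at most `δ` under `M'`. Separating the two
laws this well costs divergence at least `kl δ (1 - δ)`, and the observations made before `τ` supply
at most `∑ z, 𝔼[N z] * KL z`, where `N z` counts the samples of `z`. This is
`kl_le_sum_expectedCount`.

To stop the divergence at `τ` without conditioning on a random time, the law under `M'` is replaced
by a hybrid law, whose steps follow `M'` before `τ` and `M` afterwards. The hybrid gives the same
mass as `M'` to the part of `E` where `τ ≤ n` (`trajMeasure_inter_stopping_eq`), and its steps after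
`τ` cost nothing (`klDiv_compProd_piecewise`). The chain rule over a finite horizon
(`klDiv_trajMeasure_le`), the testing bound `test_le_klDiv` and the limit of large horizons finish
the argument.

Since the expected counts sum to `𝔼[τ]`, dividing them by `𝔼[τ]` gives one proportion vector `ω`,
valid for all `M'` at once; the infimum over `M'` and the supremum over `ω` give the theorem. -/

namespace LinMDP

open InformationTheory Preorder

/-! ### Divergence: densities, products, and the cost of a test -/

section Divergence

variable {α β : Type*} {mα : MeasurableSpace α} {mβ : MeasurableSpace β}

theorem klDiv_withDensity_eq_lintegral (ν : Measure α) [IsFiniteMeasure ν] {f : α → ℝ≥0∞}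
    (hf : Measurable f) [IsFiniteMeasure (ν.withDensity f)] :
    klDiv (ν.withDensity f) ν = ∫⁻ x, ENNReal.ofReal (klFun (f x).toReal) ∂ν := by
  rw [klDiv_eq_lintegral_klFun_of_ac (withDensity_absolutelyContinuous _ _)]
  refine lintegral_congr_ae ?_
  filter_upwards [Measure.rnDeriv_withDensity ν hf] with x hx
  rw [hx]

theorem compProd_eq_withDensity (m : Measure α) [SFinite m] (κ η : Kernel α β)
    [IsMarkovKernel κ] [IsMarkovKernel η] {f : α → β → ℝ≥0∞} (hf : Measurable (Function.uncurry f))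
    (h : ∀ x, κ x = (η x).withDensity (f x)) :
    m ⊗ₘ κ = (m ⊗ₘ η).withDensity (Function.uncurry f) := by
  have hκ : κ = η.withDensity f := by
    ext1 x
    rw [Kernel.withDensity_apply _ hf, h x]
  have : IsSFiniteKernel (η.withDensity f) := hκ ▸ inferInstance
  rw [hκ, Measure.compProd_withDensity hf]
  rfl

/-- The conditional divergence of two kernels with a jointly measurable density is the average of
the divergences. -/
theorem klDiv_compProd_eq_lintegral (m : Measure α) [IsFiniteMeasure m] (κ η : Kernel α β)
    [IsMarkovKernel κ] [IsMarkovKernel η] {f : α → β → ℝ≥0∞} (hf : Measurable (Function.uncurry f))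
    (h : ∀ x, κ x = (η x).withDensity (f x)) :
    klDiv (m ⊗ₘ κ) (m ⊗ₘ η) = ∫⁻ x, klDiv (κ x) (η x) ∂m := by
  have hd := compProd_eq_withDensity m κ η hf h
  have : IsFiniteMeasure ((m ⊗ₘ η).withDensity (Function.uncurry f)) := hd ▸ inferInstance
  rw [hd, klDiv_withDensity_eq_lintegral _ hf, Measure.lintegral_compProd (by fun_prop)]
  refine lintegral_congr fun x => ?_
  have : IsFiniteMeasure ((η x).withDensity (f x)) := h x ▸ inferInstance
  rw [h x, klDiv_withDensity_eq_lintegral _ hf.of_uncurry_left]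
  rfl

/-- Chain rule with constant kernels. In the second term the common factor is moved to the kernel
side by a swap, where it drops out; data processing for the swap suffices. -/
theorem klDiv_prod_le (μ μ' : Measure α) (ν ν' : Measure β) [IsProbabilityMeasure μ]
    [IsProbabilityMeasure μ'] [IsProbabilityMeasure ν] [IsProbabilityMeasure ν'] :
    klDiv (μ.prod ν) (μ'.prod ν') ≤ klDiv μ μ' + klDiv ν ν' := by
  have h1 := klDiv_compProd_eq_add μ μ' (Kernel.const α ν) (Kernel.const α ν')
  simp only [Measure.compProd_const] at h1
  have h2 : klDiv (μ.prod ν) (μ.prod ν') ≤ klDiv (ν.prod μ) (ν'.prod μ) := by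
    have := klDiv_map_le (ν.prod μ) (ν'.prod μ) measurable_swap
    rwa [Measure.prod_swap, Measure.prod_swap] at this
  have h3 := klDiv_compProd_left ν ν' (Kernel.const β μ)
  simp only [Measure.compProd_const] at h3
  rw [h1]
  exact add_le_add le_rfl (h2.trans h3.le)

/-- Young's inequality: `klFun` is the convex conjugate of `y ↦ exp y - 1`. -/
theorem mul_sub_exp_add_one_le_klFun {x : ℝ} (hx : 0 ≤ x) (y : ℝ) :
    x * y - Real.exp y + 1 ≤ klFun x := by
  rw [klFun_apply]
  rcases hx.eq_or_lt with rfl | hx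
  · simpa using Real.exp_nonneg y
  · have h := Real.add_one_le_exp (y - Real.log x)
    rw [Real.exp_sub, Real.exp_log hx, le_div_iff₀ hx] at h
    nlinarith

/-- A lower bound of the divergence by a test between the two measures. -/
theorem test_le_klDiv (μ ν : Measure α) [IsProbabilityMeasure μ] [IsProbabilityMeasure ν]
    {s : Set α} (hs : MeasurableSet s) {δ : ℝ} (hδ₀ : 0 < δ) (hδ₁ : δ ≤ 1 / 2)
    (hν : ν.real s ≤ δ) :
    ENNReal.ofReal ((2 * μ.real s - 1) * Real.log ((1 - δ) / δ)) ≤ klDiv μ ν := by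
  by_cases h : klDiv μ ν = ∞
  · simp [h]
  obtain ⟨hac, hint⟩ := klDiv_ne_top_iff.1 h
  rw [← ENNReal.ofReal_toReal h]
  refine ENNReal.ofReal_le_ofReal ?_
  rw [toReal_klDiv_eq_integral_klFun hac]
  set l := Real.log ((1 - δ) / δ)
  have hδ' : 0 < 1 - δ := by linarith
  have el : Real.exp l = (1 - δ) / δ := Real.exp_log (div_pos hδ' hδ₀)
  have enl : Real.exp (-l) = δ / (1 - δ) := by rw [Real.exp_neg, el, inv_div]
  -- The dual variable is the log-likelihood ratio of Bernoulli laws with means `1 - δ` and `δ`: it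
  -- is `l` on `s` and `-l` off `s`.
  let f : α → ℝ := s.indicator (fun _ => 2 * l) - fun _ => l
  have hfe : ∀ x, Real.exp (f x) =
      s.indicator (fun _ => (1 - δ) / δ - δ / (1 - δ)) x + δ / (1 - δ) := by
    intro x
    by_cases hx : x ∈ s
    · simp only [f, Pi.sub_apply, Set.indicator_of_mem hx]
      rw [show 2 * l - l = l by ring, el]; ring
    · simp only [f, Pi.sub_apply, Set.indicator_of_notMem hx]
      rw [zero_sub, enl]; ring
  have hi1 : Integrable (fun x => (μ.rnDeriv ν x).toReal * f x) ν := by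
    have hf : Integrable f μ := ((integrable_const _).indicator hs).sub (integrable_const _)
    exact (integrable_toReal_rnDeriv_mul_iff hac).2 hf
  have hi2 : Integrable (fun x => Real.exp (f x)) ν := by
    simp_rw [hfe]
    exact ((integrable_const _).indicator hs).add (integrable_const _)
  have I1 : ∫ x, (μ.rnDeriv ν x).toReal * f x ∂ν = (2 * μ.real s - 1) * l := by
    have := integral_rnDeriv_smul (f := f) hac
    simp only [smul_eq_mul] at this
    rw [this]
    simp only [f, Pi.sub_apply]
    rw [integral_sub ((integrable_const _).indicator hs) (integrable_const _),
      integral_indicator_const _ hs]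
    simp; ring
  have I2 : ∫ x, Real.exp (f x) ∂ν ≤ 1 := by
    simp_rw [hfe]
    rw [integral_add ((integrable_const _).indicator hs) (integrable_const _),
      integral_indicator_const _ hs]
    simp only [smul_eq_mul, integral_const, probReal_univ, one_mul]
    -- The exponential moment is affine in the mass of `s`, with nonnegative slope because `δ ≤ 1 /
    -- 2`, and equals one at mass `δ`.
    have h0 : 0 ≤ (1 - δ) / δ - δ / (1 - δ) := by
      rw [sub_nonneg, div_le_div_iff₀ hδ' hδ₀]; nlinarith
    calc ν.real s * ((1 - δ) / δ - δ / (1 - δ)) + δ / (1 - δ)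
        ≤ δ * ((1 - δ) / δ - δ / (1 - δ)) + δ / (1 - δ) := by gcongr
      _ = 1 := by field_simp; ring
  calc (2 * μ.real s - 1) * l
      ≤ (2 * μ.real s - 1) * l - ∫ x, Real.exp (f x) ∂ν + 1 := by linarith
    _ = ∫ x, ((μ.rnDeriv ν x).toReal * f x - Real.exp (f x) + 1) ∂ν := by
        have h1 := integral_add (hi1.sub hi2) (integrable_const (1 : ℝ))
        simp only [Pi.sub_apply] at h1
        rw [h1, integral_sub hi1 hi2, I1]
        simp
    _ ≤ ∫ x, klFun (μ.rnDeriv ν x).toReal ∂ν :=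
        integral_mono ((hi1.sub hi2).add (integrable_const _))
          ((integrable_klFun_rnDeriv_iff hac).2 hint)
          fun x => mul_sub_exp_add_one_le_klFun ENNReal.toReal_nonneg _

theorem bernoulliLaw_singleton {a : ℝ} (h₀ : 0 ≤ a) (h₁ : a ≤ 1) (b : Bool) :
    bernoulliLaw a {b} = ENNReal.ofReal (if b then a else 1 - a) := by
  have hp : Set.projIcc (0 : ℝ) 1 zero_le_one a = ⟨a, h₀, h₁⟩ := Set.projIcc_of_mem _ ⟨h₀, h₁⟩
  rw [bernoulliLaw, hp]
  cases b
  · rw [bernoulliMeasure_apply_of_notMem_of_mem _ (by simp) (by simp) (by simp)]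
    simp only [Bool.false_eq_true, if_false]
    rw [ENNReal.ofReal, Real.toNNReal_of_nonneg (by linarith)]
    rfl
  · rw [bernoulliMeasure_apply_of_mem_of_notMem _ (by simp) (by simp) (by simp)]
    simp only [if_true]
    rw [ENNReal.ofReal, Real.toNNReal_of_nonneg h₀]
    rfl

instance (a : ℝ) : IsProbabilityMeasure (bernoulliLaw a) := by
  unfold bernoulliLaw; infer_instance

/-- The right side is kept in the shape of the bound in `test_le_klDiv` at mass `1 - δ`, so that the
testing bound loses nothing there. -/
theorem kl_self_one_sub {δ : ℝ} (hδ₀ : 0 < δ) (hδ₁ : δ ≤ 1 / 2) :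
    kl δ (1 - δ) = ENNReal.ofReal ((2 * (1 - δ) - 1) * Real.log ((1 - δ) / δ)) := by
  have hδ' : 0 < 1 - δ := by linarith
  let f : Bool → ℝ≥0∞ := fun b => ENNReal.ofReal (if b then δ / (1 - δ) else (1 - δ) / δ)
  have hd : bernoulliLaw δ = (bernoulliLaw (1 - δ)).withDensity f := by
    refine Measure.ext_of_singleton fun b => ?_
    rw [withDensity_apply _ (MeasurableSet.singleton b), lintegral_singleton,
      bernoulliLaw_singleton hδ₀.le (by linarith),
      bernoulliLaw_singleton hδ'.le (by linarith), ← ENNReal.ofReal_mul (by split_ifs <;> positivity)]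
    congr 1
    cases b <;> simp <;> field_simp
  have : IsFiniteMeasure ((bernoulliLaw (1 - δ)).withDensity f) := hd ▸ inferInstance
  rw [kl, hd, klDiv_withDensity_eq_lintegral _ (measurable_of_finite f), lintegral_fintype]
  simp only [Fintype.sum_bool, f, bernoulliLaw_singleton hδ'.le (show 1 - δ ≤ 1 by linarith),
    if_true, Bool.false_eq_true, if_false]
  rw [ENNReal.toReal_ofReal (by positivity), ENNReal.toReal_ofReal (by positivity),
    ← ENNReal.ofReal_mul (klFun_nonneg (by positivity)),
    ← ENNReal.ofReal_mul (klFun_nonneg (by positivity)),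
    ← ENNReal.ofReal_add (mul_nonneg (klFun_nonneg (by positivity)) (by linarith))
      (mul_nonneg (klFun_nonneg (by positivity)) (by linarith))]
  congr 1
  rw [klFun_apply, klFun_apply, Real.log_div hδ₀.ne' hδ'.ne', Real.log_div hδ'.ne' hδ₀.ne']
  field_simp
  ring

end Divergence

/-! ### Chain rule for trajectory laws -/

section Trajectory

variable {X : ℕ → Type*} [∀ n, MeasurableSpace (X n)] {μ₀ : Measure (X 0)}
  {κ η : (n : ℕ) → Kernel ((i : Finset.Iic n) → X i) (X (n + 1))}
  [∀ n, IsMarkovKernel (κ n)] [∀ n, IsMarkovKernel (η n)]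

theorem trajMeasure_map_frestrictLe_zero :
    (Kernel.trajMeasure μ₀ κ).map (frestrictLe 0) =
      (Kernel.trajMeasure μ₀ η).map (frestrictLe 0) := by
  rw [Kernel.trajMeasure, Kernel.trajMeasure, Measure.map_comp _ _ (by fun_prop),
    Measure.map_comp _ _ (by fun_prop), Kernel.traj_map_frestrictLe, Kernel.traj_map_frestrictLe,
    Kernel.partialTraj_self, Kernel.partialTraj_self]

/-- Makes the law of a longer history the image of a composition-product, to which the chain rule
applies. -/
theorem exists_frestrictLe_succ_eq (n : ℕ) :
    ∃ g : ((i : Finset.Iic n) → X i) × X (n + 1) → (i : Finset.Iic (n + 1)) → X i,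
      Measurable g ∧ (frestrictLe (n + 1) : ((n : ℕ) → X n) → _) =
        g ∘ fun x => (frestrictLe n x, x (n + 1)) := by
  refine ⟨fun p => IicProdIoc n (n + 1) (p.1, MeasurableEquiv.piSingleton n p.2), by fun_prop, ?_⟩
  ext x i
  rcases i with ⟨i, hi⟩
  by_cases h : i ≤ n
  · simp [IicProdIoc, h]
  · obtain rfl : i = n + 1 := by have := Finset.mem_Iic.1 hi; omega
    simp [IicProdIoc, MeasurableEquiv.piSingleton]

variable [IsProbabilityMeasure μ₀]

theorem klDiv_trajMeasure_succ_le (n : ℕ) :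
    klDiv ((Kernel.trajMeasure μ₀ κ).map (frestrictLe (n + 1)))
        ((Kernel.trajMeasure μ₀ η).map (frestrictLe (n + 1))) ≤
      klDiv ((Kernel.trajMeasure μ₀ κ).map (frestrictLe n))
        ((Kernel.trajMeasure μ₀ η).map (frestrictLe n)) +
      klDiv ((Kernel.trajMeasure μ₀ κ).map (frestrictLe n) ⊗ₘ κ n)
        ((Kernel.trajMeasure μ₀ κ).map (frestrictLe n) ⊗ₘ η n) := by
  obtain ⟨g, hg, hgc⟩ := exists_frestrictLe_succ_eq (X := X) n
  have key : ∀ (ξ : (n : ℕ) → Kernel ((i : Finset.Iic n) → X i) (X (n + 1)))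
      [∀ n, IsMarkovKernel (ξ n)], (Kernel.trajMeasure μ₀ ξ).map (frestrictLe (n + 1)) =
        ((Kernel.trajMeasure μ₀ ξ).map (frestrictLe n) ⊗ₘ ξ n).map g := by
    intro ξ _
    rw [Kernel.map_frestrictLe_trajMeasure_compProd_eq_map_trajMeasure,
      Measure.map_map hg (by fun_prop), hgc]
  have := Measure.isProbabilityMeasure_map (μ := Kernel.trajMeasure μ₀ κ)
    (measurable_frestrictLe (X := X) n).aemeasurable
  have := Measure.isProbabilityMeasure_map (μ := Kernel.trajMeasure μ₀ η)
    (measurable_frestrictLe (X := X) n).aemeasurable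
  rw [key κ, key η]
  rw [← klDiv_compProd_eq_add]
  exact klDiv_map_le _ _ hg

theorem klDiv_trajMeasure_le (n : ℕ) :
    klDiv ((Kernel.trajMeasure μ₀ κ).map (frestrictLe n))
        ((Kernel.trajMeasure μ₀ η).map (frestrictLe n)) ≤
      ∑ k ∈ Finset.range n, klDiv ((Kernel.trajMeasure μ₀ κ).map (frestrictLe k) ⊗ₘ κ k)
        ((Kernel.trajMeasure μ₀ κ).map (frestrictLe k) ⊗ₘ η k) := by
  induction n with
  | zero =>
    have := Measure.isProbabilityMeasure_map (μ := Kernel.trajMeasure μ₀ η)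
      (measurable_frestrictLe (X := X) 0).aemeasurable
    rw [trajMeasure_map_frestrictLe_zero (κ := κ) (η := η), klDiv_self]
    exact zero_le
  | succ n ih =>
    rw [Finset.sum_range_succ]
    exact (klDiv_trajMeasure_succ_le n).trans (add_le_add ih le_rfl)

end Trajectory


/-! ### Hybrid trajectory laws and stopping times -/

section Stopping

variable {X : ℕ → Type*} [∀ n, MeasurableSpace (X n)]

theorem exists_frestrictLe_preimage {n : ℕ} {s : Set ((n : ℕ) → X n)}
    (hs : MeasurableSet[Filtration.piLE (X := X) n] s) :
    ∃ t, MeasurableSet t ∧ frestrictLe n ⁻¹' t = s := by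
  rw [Filtration.piLE_eq_comap_frestrictLe] at hs
  exact hs

variable {μ₀ : Measure (X 0)} [IsProbabilityMeasure μ₀]
  {κ η ξ : (n : ℕ) → Kernel ((i : Finset.Iic n) → X i) (X (n + 1))}
  [∀ n, IsMarkovKernel (κ n)] [∀ n, IsMarkovKernel (η n)] [∀ n, IsMarkovKernel (ξ n)]
  {τ : ((n : ℕ) → X n) → ℕ∞} {A : (n : ℕ) → Set ((i : Finset.Iic n) → X i)}

/-- Two trajectory laws whose steps agree as long as the stopping time has not occurred agree up to
this time. -/
theorem trajMeasure_inter_le_eq (hAm : ∀ n, MeasurableSet (A n))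
    (hA : ∀ n : ℕ, frestrictLe n ⁻¹' A n = {x | τ x ≤ n})
    (h : ∀ n, ∀ x ∉ A n, ξ n x = η n x) (n : ℕ) {B : Set ((i : Finset.Iic n) → X i)}
    (hB : MeasurableSet B) :
    Kernel.trajMeasure μ₀ ξ (frestrictLe n ⁻¹' B ∩ {x | n ≤ τ x}) =
      Kernel.trajMeasure μ₀ η (frestrictLe n ⁻¹' B ∩ {x | n ≤ τ x}) := by
  induction n with
  | zero =>
    have hu : {x : (n : ℕ) → X n | ((0 : ℕ) : ℕ∞) ≤ τ x} = Set.univ := by ext; simp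
    rw [hu, Set.inter_univ, ← Measure.map_apply (measurable_frestrictLe 0) hB,
      ← Measure.map_apply (measurable_frestrictLe 0) hB,
      trajMeasure_map_frestrictLe_zero (κ := ξ) (η := η)]
  | succ n ih =>
    obtain ⟨g, hg, hgc⟩ := exists_frestrictLe_succ_eq (X := X) n
    have hset : frestrictLe (n + 1) ⁻¹' B ∩ {x | ((n + 1 : ℕ) : ℕ∞) ≤ τ x} =
        (fun x : (n : ℕ) → X n => (frestrictLe n x, x (n + 1))) ⁻¹'
          (Prod.fst ⁻¹' (A n)ᶜ ∩ g ⁻¹' B) := by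
      -- Not having stopped by time `n` is already decided by the history up to `n`, so the next
      -- step is taken only where `ξ` and `η` agree.
      have hlt : {x | ((n + 1 : ℕ) : ℕ∞) ≤ τ x} = (frestrictLe n ⁻¹' A n)ᶜ := by
        rw [hA]
        ext x
        simp only [Set.mem_ofPred_eq, Set.mem_compl_iff, not_le]
        rw [Nat.cast_add, Nat.cast_one, ENat.add_one_le_iff (ENat.natCast_ne_top n)]
      rw [hlt, hgc, Set.inter_comm]
      rfl
    have hm : MeasurableSet (Prod.fst ⁻¹' (A n)ᶜ ∩ g ⁻¹' B) :=
      (measurable_fst (hAm n).compl).inter (hg hB)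
    have key : ∀ (ζ : (n : ℕ) → Kernel ((i : Finset.Iic n) → X i) (X (n + 1)))
        [∀ n, IsMarkovKernel (ζ n)],
        Kernel.trajMeasure μ₀ ζ (frestrictLe (n + 1) ⁻¹' B ∩ {x | ((n + 1 : ℕ) : ℕ∞) ≤ τ x}) =
          ∫⁻ y in (A n)ᶜ, ζ n y (Prod.mk y ⁻¹' (g ⁻¹' B))
            ∂(Kernel.trajMeasure μ₀ ζ).map (frestrictLe n) := by
      intro ζ _
      rw [hset, ← Measure.map_apply (by fun_prop) hm,
        ← Kernel.map_frestrictLe_trajMeasure_compProd_eq_map_trajMeasure,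
        Measure.compProd_apply hm, ← lintegral_indicator (hAm n).compl]
      refine lintegral_congr fun y => ?_
      by_cases hy : y ∈ A n
      · rw [Set.indicator_of_notMem (by simpa using hy)]
        convert measure_empty (μ := ζ n y)
        ext; simp [hy]
      · rw [Set.indicator_of_mem (by simpa using hy)]
        congr 1
        ext; simp [hy]
    have hr : ((Kernel.trajMeasure μ₀ ξ).map (frestrictLe n)).restrict (A n)ᶜ =
        ((Kernel.trajMeasure μ₀ η).map (frestrictLe n)).restrict (A n)ᶜ := by
      ext C hC
      have hCA := hC.inter (hAm n).compl
      rw [Measure.restrict_apply hC, Measure.restrict_apply hC,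
        Measure.map_apply (measurable_frestrictLe n) hCA,
        Measure.map_apply (measurable_frestrictLe n) hCA]
      -- Off `A n` the stopping time exceeds `n`, which places the event within reach of the
      -- induction hypothesis.
      have hsub : frestrictLe n ⁻¹' (C ∩ (A n)ᶜ) =
          frestrictLe n ⁻¹' (C ∩ (A n)ᶜ) ∩ {x | (n : ℕ∞) ≤ τ x} := by
        refine (Set.inter_eq_left.2 fun x hx => ?_).symm
        have : x ∉ frestrictLe n ⁻¹' A n := hx.2
        rw [hA] at this
        have hlt : ¬ τ x ≤ (n : ℕ∞) := this
        exact (not_le.1 hlt).le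
      rw [hsub]
      exact ih hCA
    rw [key ξ, key η, hr]
    exact setLIntegral_congr_fun (hAm n).compl fun y hy => by rw [h n y hy]

/-- Split by the value `k` of `τ`: each piece is known at time `k` and lies in `{k ≤ τ}`, where the
two laws agree. -/
theorem trajMeasure_inter_stopping_eq (hτ : IsStoppingTime (Filtration.piLE (X := X)) τ)
    (hAm : ∀ n, MeasurableSet (A n)) (hA : ∀ n : ℕ, frestrictLe n ⁻¹' A n = {x | τ x ≤ n})
    (h : ∀ n, ∀ x ∉ A n, ξ n x = η n x) {E : Set ((n : ℕ) → X n)}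
    (hE : MeasurableSet[hτ.measurableSpace] E) (n : ℕ) :
    Kernel.trajMeasure μ₀ ξ (E ∩ {x | τ x ≤ n}) =
      Kernel.trajMeasure μ₀ η (E ∩ {x | τ x ≤ n}) := by
  have hun : E ∩ {x | τ x ≤ n} = ⋃ k ∈ Finset.range (n + 1), (E ∩ {x | τ x = (k : ℕ)}) := by
    ext x
    simp only [Set.mem_inter_iff, Set.mem_ofPred_eq, Set.mem_iUnion, Finset.mem_range,
      exists_prop]
    constructor
    · rintro ⟨hx, hn⟩
      obtain ⟨k, hk⟩ := ENat.ne_top_iff_exists.1 (ne_top_of_le_ne_top (ENat.natCast_ne_top n) hn)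
      rw [← hk] at hn
      exact ⟨k, Nat.lt_succ_of_le (by exact_mod_cast hn), hx, hk.symm⟩
    · rintro ⟨k, hk, hx, hxk⟩
      refine ⟨hx, ?_⟩
      rw [hxk]
      exact_mod_cast Nat.lt_succ_iff.1 hk
  have hmeas : ∀ k : ℕ, MeasurableSet[Filtration.piLE (X := X) k] (E ∩ {x | τ x = (k : ℕ)}) :=
    fun k => (hτ.measurableSet_inter_eq_iff E k).1 (hE.inter (hτ.measurableSet_eq_of_countable' k))
  have hdisj : Set.PairwiseDisjoint (Finset.range (n + 1) : Set ℕ)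
      fun k => E ∩ {x | τ x = (k : ℕ)} := by
    intro i _ j _ hij
    refine Set.disjoint_left.2 fun x hi hj => hij ?_
    have := hi.2.symm.trans hj.2
    exact_mod_cast this
  rw [hun, measure_biUnion_finset hdisj fun k _ => Filtration.piLE.le k _ (hmeas k),
    measure_biUnion_finset hdisj fun k _ => Filtration.piLE.le k _ (hmeas k)]
  refine Finset.sum_congr rfl fun k _ => ?_
  obtain ⟨B, hB, hBE⟩ := exists_frestrictLe_preimage (hmeas k)
  have : E ∩ {x | τ x = (k : ℕ)} = frestrictLe k ⁻¹' B ∩ {x | (k : ℕ∞) ≤ τ x} := by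
    rw [hBE]
    exact (Set.inter_eq_left.2 fun x hx => (hx.2 : τ x = k).ge).symm
  rw [this]
  exact trajMeasure_inter_le_eq hAm hA h k hB

/-- Change of measure at a stopping time: a test which is known at that time is paid for by the
conditional divergences of the steps before it. -/
theorem test_le_sum_klDiv (hτ : IsStoppingTime (Filtration.piLE (X := X)) τ)
    (hAm : ∀ n, MeasurableSet (A n)) (hA : ∀ n : ℕ, frestrictLe n ⁻¹' A n = {x | τ x ≤ n})
    (h : ∀ n, ∀ x ∉ A n, ξ n x = η n x) {E : Set ((n : ℕ) → X n)}
    (hE : MeasurableSet[hτ.measurableSpace] E) {δ : ℝ} (hδ₀ : 0 < δ) (hδ₁ : δ ≤ 1 / 2)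
    (hη : (Kernel.trajMeasure μ₀ η).real E ≤ δ) (n : ℕ) :
    ENNReal.ofReal ((2 * (Kernel.trajMeasure μ₀ κ).real (E ∩ {x | τ x ≤ n}) - 1) *
        Real.log ((1 - δ) / δ)) ≤
      ∑ k ∈ Finset.range n, klDiv ((Kernel.trajMeasure μ₀ κ).map (frestrictLe k) ⊗ₘ κ k)
        ((Kernel.trajMeasure μ₀ κ).map (frestrictLe k) ⊗ₘ ξ k) := by
  refine le_trans ?_ (klDiv_trajMeasure_le n)
  obtain ⟨B, hB, hBE'⟩ := exists_frestrictLe_preimage (hE.2 n)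
  have hBE : frestrictLe n ⁻¹' B = E ∩ {x | τ x ≤ (n : ℕ∞)} := hBE'
  have := Measure.isProbabilityMeasure_map (μ := Kernel.trajMeasure μ₀ κ)
    (measurable_frestrictLe (X := X) n).aemeasurable
  have := Measure.isProbabilityMeasure_map (μ := Kernel.trajMeasure μ₀ ξ)
    (measurable_frestrictLe (X := X) n).aemeasurable
  have hBξ : ((Kernel.trajMeasure μ₀ ξ).map (frestrictLe n)).real B ≤ δ := by
    rw [map_measureReal_apply (measurable_frestrictLe n) hB, hBE, measureReal_def,
      trajMeasure_inter_stopping_eq hτ hAm hA h hE n]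
    exact (measureReal_mono Set.inter_subset_left).trans hη
  have ht := test_le_klDiv ((Kernel.trajMeasure μ₀ κ).map (frestrictLe n)) _ hB hδ₀ hδ₁ hBξ
  rwa [map_measureReal_apply (measurable_frestrictLe n) hB, hBE] at ht

end Stopping

/-! ### Divergence of one sampling step -/

section Steps

variable {Y Z W : Type*} [MeasurableSpace Y] [MeasurableSpace Z] [MeasurableSpace W]

theorem compProd_prodMkLeft_apply (σ : Kernel Y Z) (ρ : Kernel Z W) [IsMarkovKernel σ]
    [IsMarkovKernel ρ] (y : Y) : (σ ⊗ₖ Kernel.prodMkLeft Y ρ) y = σ y ⊗ₘ ρ := by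
  rw [Kernel.compProd_apply_eq_compProd_sectR, Kernel.sectR_prodMkLeft]

/-- On `B` both steps coincide and cost nothing. Off `B` the choice `σ` of the pair is common to
both steps, so only the divergence of the responses remains. -/
theorem klDiv_compProd_piecewise [Countable Z] [DiscreteMeasurableSpace Z] (m : Measure Y)
    [IsFiniteMeasure m] (σ : Kernel Y Z) (ρ ρ' : Kernel Z W) [IsMarkovKernel σ] [IsMarkovKernel ρ]
    [IsMarkovKernel ρ'] (hac : ∀ z, ρ z ≪ ρ' z) {B : Set Y} [DecidablePred (· ∈ B)] (hB : MeasurableSet B) :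
    klDiv (m ⊗ₘ (σ ⊗ₖ Kernel.prodMkLeft Y ρ)) (m ⊗ₘ Kernel.piecewise hB
        (σ ⊗ₖ Kernel.prodMkLeft Y ρ) (σ ⊗ₖ Kernel.prodMkLeft Y ρ')) =
      ∫⁻ p in Prod.fst ⁻¹' Bᶜ, klDiv (ρ p.2.1) (ρ' p.2.1)
        ∂(m ⊗ₘ (σ ⊗ₖ Kernel.prodMkLeft Y ρ)) := by
  -- Countability of `Z` makes this choice of densities, one for each `z`, jointly measurable.
  let g : Z → W → ℝ≥0∞ := fun z => (ρ z).rnDeriv (ρ' z)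
  have hg : Measurable (Function.uncurry g) :=
    measurable_from_prod_countable_right fun z => Measure.measurable_rnDeriv (ρ z) (ρ' z)
  have hgρ : ∀ z, ρ z = (ρ' z).withDensity (g z) := fun z =>
    (Measure.withDensity_rnDeriv_eq _ _ (hac z)).symm
  let f : Y → Z × W → ℝ≥0∞ := fun y q => if y ∈ B then 1 else Function.uncurry g q
  have hf : Measurable (Function.uncurry f) :=
    Measurable.ite (measurable_fst hB) measurable_const (hg.comp measurable_snd)
  rw [klDiv_compProd_eq_lintegral m _ _ hf]
  · have hmk : Measurable fun p : Y × Z × W => klDiv (ρ p.2.1) (ρ' p.2.1) :=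
      (Measurable.of_discrete (f := fun z => klDiv (ρ z) (ρ' z))).comp
        (measurable_fst.comp measurable_snd)
    rw [← lintegral_indicator (measurable_fst hB.compl),
      Measure.lintegral_compProd (hmk.indicator (measurable_fst hB.compl))]
    refine lintegral_congr fun y => ?_
    by_cases hy : y ∈ B
    · simp [Kernel.piecewise_apply, hy, Set.indicator]
    · simp only [Kernel.piecewise_apply, hy, if_false, Set.indicator, Set.mem_preimage,
        Set.mem_compl_iff, not_false_eq_true, if_true]
      rw [compProd_prodMkLeft_apply, compProd_prodMkLeft_apply,
        klDiv_compProd_eq_lintegral (σ y) ρ ρ' hg hgρ, Measure.lintegral_compProd]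
      · simp
      · exact (Measurable.of_discrete (f := fun z => klDiv (ρ z) (ρ' z))).comp measurable_fst
  · intro y
    by_cases hy : y ∈ B
    · have : f y = 1 := by ext q; simp [f, hy]
      rw [this, withDensity_one, Kernel.piecewise_apply, if_pos hy]
    · have : f y = Function.uncurry g := by ext q; simp [f, hy]
      rw [this, Kernel.piecewise_apply, if_neg hy, compProd_prodMkLeft_apply,
        compProd_prodMkLeft_apply]
      exact compProd_eq_withDensity (σ y) ρ ρ' hg hgρ

end Steps

/-! ### Divergence of a single response -/

namespace MDP

variable {S A : Type u} [MeasurableSpace S] [DiscreteMeasurableSpace S] [Countable S] [Countable A]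
  [MeasurableSpace A] [DiscreteMeasurableSpace A]

theorem klDiv_response_le (M M' : MDP S A) (z : S × A) :
    klDiv (M.response z) (M'.response z) ≤ M.klMDP M' z.1 z.2 :=
  klDiv_prod_le _ _ _ _

theorem AbsCont.response {M M' : MDP S A} (h : M.AbsCont M') (z : S × A) :
    M.response z ≪ M'.response z :=
  (h z.1 z.2).2.prod (h z.1 z.2).1

end MDP

/-! ### Sample counts and the change of measure for an algorithm -/

namespace Algorithm

variable {S A U : Type u} [MeasurableSpace S] [MeasurableSpace A] [MeasurableSpace U]
  [DiscreteMeasurableSpace S] [DiscreteMeasurableSpace A]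

instance [Countable S] [Countable A] (alg : Algorithm S A U) (M : MDP S A) :
    IsProbabilityMeasure (alg.law M) :=
  inferInstanceAs (IsProbabilityMeasure
    (Kernel.trajMeasure (X := Coord S A U) alg.seed (alg.step M)))

/-- The pair that is selected for the sample number `k + 1`. -/
def pair (k : ℕ) (x : Run S A U) : S × A := Prod.fst (α := S × A) (β := ℝ × S) (x (k + 1))

omit [DiscreteMeasurableSpace S] [DiscreteMeasurableSpace A] in
theorem measurable_pair (k : ℕ) : Measurable (pair (S := S) (A := A) (U := U) k) :=
  (measurable_fst (α := S × A) (β := ℝ × S)).comp (measurable_pi_apply (k + 1))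

/-- The expected number of times the pair `z` is sampled. -/
noncomputable def expectedCount [Countable S] [Countable A] (alg : Algorithm S A U) (M : MDP S A)
    (z : S × A) : ℝ≥0∞ :=
  ∑' k : ℕ, alg.law M ({x | (k : ℕ∞) < alg.τ x} ∩ pair k ⁻¹' {z})

omit [DiscreteMeasurableSpace S] [DiscreteMeasurableSpace A] in
theorem measurableSet_lt_τ (alg : Algorithm S A U) (k : ℕ) :
    MeasurableSet {x | (k : ℕ∞) < alg.τ x} := by
  have : {x | (k : ℕ∞) < alg.τ x} = {x | alg.τ x ≤ (k : ℕ∞)}ᶜ := by ext; simp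
  rw [this]
  exact ((runFiltration S A U).le k _ (alg.isStoppingTime_τ k)).compl

theorem toENNReal_eq_tsum (n : ℕ∞) : (n : ℝ≥0∞) = ∑' k : ℕ, if (k : ℕ∞) < n then 1 else 0 := by
  induction n using ENat.recTopCoe with
  | top => simp
  | coe n =>
    rw [tsum_eq_sum (s := Finset.range n) fun k hk => by simpa using hk]
    rw [Finset.sum_congr rfl fun k hk => if_pos (by simpa using hk)]
    simp

theorem expectedTime_eq_tsum [Countable S] [Countable A] (alg : Algorithm S A U) (M : MDP S A) :
    alg.expectedTime M = ∑' k : ℕ, alg.law M {x | (k : ℕ∞) < alg.τ x} := by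
  classical
  rw [expectedTime]
  simp_rw [toENNReal_eq_tsum]
  rw [lintegral_tsum fun k =>
    (Measurable.ite (alg.measurableSet_lt_τ k) measurable_const measurable_const).aemeasurable]
  refine tsum_congr fun k => ?_
  rw [← lintegral_indicator_one (alg.measurableSet_lt_τ k)]
  refine lintegral_congr fun x => ?_
  simp [Set.indicator_apply]

theorem setLIntegral_comp_pair [Fintype S] [Fintype A] (μ : Measure (Run S A U))
    (s : Set (Run S A U)) (k : ℕ) (K : S × A → ℝ≥0∞) :
    ∫⁻ x in s, K (pair k x) ∂μ = ∑ z, K z * μ (s ∩ pair k ⁻¹' {z}) := by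
  rw [← lintegral_map (f := K) Measurable.of_discrete (measurable_pair k), lintegral_fintype]
  refine Finset.sum_congr rfl fun z _ => ?_
  rw [Measure.map_apply (measurable_pair k) (measurableSet_singleton z),
    Measure.restrict_apply (measurable_pair k (measurableSet_singleton z)), Set.inter_comm]

theorem sum_expectedCount [Fintype S] [Fintype A] (alg : Algorithm S A U) (M : MDP S A) :
    ∑ z, alg.expectedCount M z = alg.expectedTime M := by
  rw [expectedTime_eq_tsum]
  simp only [expectedCount]
  rw [← Summable.tsum_finsetSum fun _ _ => ENNReal.summable]
  refine tsum_congr fun k => ?_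
  have := setLIntegral_comp_pair (alg.law M) {x | (k : ℕ∞) < alg.τ x} k 1
  simpa using this.symm

theorem map_frestrictLe_law_compProd [Countable S] [Countable A] (alg : Algorithm S A U)
    (M : MDP S A) (k : ℕ) : (alg.law M).map (frestrictLe k) ⊗ₘ alg.step M k =
      (alg.law M).map fun x => (frestrictLe k x, x (k + 1)) :=
  Kernel.map_frestrictLe_trajMeasure_compProd_eq_map_trajMeasure

/-- Step `k` of the hybrid run is charged only on `k < τ`, exactly when sample number `k + 1` is
counted. -/
theorem klDiv_step_le [Fintype S] [Fintype A] (alg : Algorithm S A U) {M M' : MDP S A}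
    (hac : M.AbsCont M') (k : ℕ) {B : Set (History S A U k)} [DecidablePred (· ∈ B)] (hBm : MeasurableSet B)
    (hB : frestrictLe k ⁻¹' B = {x | alg.τ x ≤ (k : ℕ∞)}) :
    klDiv ((alg.law M).map (frestrictLe k) ⊗ₘ alg.step M k)
      ((alg.law M).map (frestrictLe k) ⊗ₘ
        Kernel.piecewise hBm (alg.step M k) (alg.step M' k)) ≤
      ∑ z, M.klMDP M' z.1 z.2 *
        alg.law M ({x | (k : ℕ∞) < alg.τ x} ∩ pair k ⁻¹' {z}) := by
  have := Measure.isProbabilityMeasure_map (μ := alg.law M)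
    (measurable_frestrictLe (X := Coord S A U) k).aemeasurable
  have hK : Measurable fun p : History S A U k × ((S × A) × (ℝ × S)) =>
      klDiv (M.response p.2.1) (M'.response p.2.1) :=
    (Measurable.of_discrete (f := fun z => klDiv (M.response z) (M'.response z))).comp
      (measurable_fst.comp measurable_snd)
  have hs : (fun x : Run S A U => (frestrictLe k x, x (k + 1))) ⁻¹'
      (Prod.fst ⁻¹' Bᶜ) = {x | (k : ℕ∞) < alg.τ x} := by
    ext x
    have := Set.ext_iff.1 hB x
    exact (not_congr this).trans (not_le (a := alg.τ x) (b := (k : ℕ∞)))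
  have hm : Measurable fun x : Run S A U => (frestrictLe (π := Coord S A U) k x, x (k + 1)) :=
    (measurable_frestrictLe k).prodMk (measurable_pi_apply (k + 1))
  have h1 : klDiv ((alg.law M).map (frestrictLe k) ⊗ₘ alg.step M k)
      ((alg.law M).map (frestrictLe k) ⊗ₘ
        Kernel.piecewise hBm (alg.step M k) (alg.step M' k)) =
      ∫⁻ p in Prod.fst ⁻¹' Bᶜ, klDiv (M.response p.2.1) (M'.response p.2.1)
        ∂((alg.law M).map (frestrictLe k) ⊗ₘ alg.step M k) :=
    klDiv_compProd_piecewise ((alg.law M).map (frestrictLe k)) (alg.sample k) M.response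
      M'.response hac.response hBm
  rw [h1, map_frestrictLe_law_compProd, setLIntegral_map (measurable_fst hBm.compl) hK hm, hs,
    ← setLIntegral_comp_pair (alg.law M) _ k fun z => M.klMDP M' z.1 z.2]
  exact lintegral_mono fun x => MDP.klDiv_response_le M M' (pair k x)

theorem test_le_sum_expectedCount [Fintype S] [Fintype A] (alg : Algorithm S A U) {M M' : MDP S A}
    (hac : M.AbsCont M') {E : Set (Run S A U)}
    (hE : MeasurableSet[alg.isStoppingTime_τ.measurableSpace] E) {δ : ℝ} (hδ₀ : 0 < δ)
    (hδ₁ : δ ≤ 1 / 2) (hM' : (alg.law M').real E ≤ δ) (n : ℕ) :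
    ENNReal.ofReal ((2 * (alg.law M).real (E ∩ {x | alg.τ x ≤ (n : ℕ∞)}) - 1) *
        Real.log ((1 - δ) / δ)) ≤ ∑ z, alg.expectedCount M z * M.klMDP M' z.1 z.2 := by
  classical
  -- `B k` expresses `τ ≤ k` through the history alone, so switching from `M'` to `M` on it still
  -- defines a kernel.
  choose B hBm hB using fun k => exists_frestrictLe_preimage (alg.isStoppingTime_τ k)
  have h := test_le_sum_klDiv (X := Coord S A U) (μ₀ := alg.seed) (κ := alg.step M)
    (η := alg.step M') (ξ := fun k => Kernel.piecewise (hBm k) (alg.step M k) (alg.step M' k))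
    alg.isStoppingTime_τ hBm hB (fun k x hx => by rw [Kernel.piecewise_apply, if_neg hx]) hE hδ₀
    hδ₁ hM' n
  refine h.trans ?_
  calc _ ≤ ∑ k ∈ Finset.range n, ∑ z, M.klMDP M' z.1 z.2 *
        alg.law M ({x | (k : ℕ∞) < alg.τ x} ∩ pair k ⁻¹' {z}) :=
        Finset.sum_le_sum fun k _ => alg.klDiv_step_le hac k (hBm k) (hB k)
    _ ≤ ∑' k : ℕ, ∑ z, M.klMDP M' z.1 z.2 *
        alg.law M ({x | (k : ℕ∞) < alg.τ x} ∩ pair k ⁻¹' {z}) := ENNReal.sum_le_tsum _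
    _ = _ := by
        rw [Summable.tsum_finsetSum fun _ _ => ENNReal.summable]
        refine Finset.sum_congr rfl fun z _ => ?_
        rw [ENNReal.tsum_mul_left, mul_comm]
        rfl

/-- The success event for `M` is the test: the PAC property makes it likely under `M` and, by
disjointness of the ε-optimal sets, unlikely under `M'`. -/
theorem kl_le_sum_expectedCount [Fintype S] [Fintype A] {d : ℕ}
    {φ : S → A → EuclideanSpace ℝ (Fin d)} {ν : Measure ℝ} {γ ε δ : ℝ} (hδ₀ : 0 < δ)
    (hδ₁ : δ ≤ 1 / 2) {alg : Algorithm S A U} (hPAC : alg.IsPAC φ ν γ ε δ) {M M' : MDP S A}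
    (hM : M ∈ linearMDPs φ ν γ) (hM' : M' ∈ altMDPs φ ν γ ε M) :
    kl δ (1 - δ) ≤ ∑ z, alg.expectedCount M z * M.klMDP M' z.1 z.2 := by
  obtain ⟨hM'l, hac, hdisj⟩ := hM'
  have hE : ∀ P : Set (Policy S A), MeasurableSet[alg.isStoppingTime_τ.measurableSpace]
      {x | alg.τ x < ⊤ ∧ alg.decision x ∈ P} := by
    intro P
    have h1 : MeasurableSet[alg.isStoppingTime_τ.measurableSpace] {x | alg.τ x < ⊤} := by
      have : {x | alg.τ x < ⊤} = ⋃ k : ℕ, {x | alg.τ x = (k : ℕ)} := by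
        ext x
        simp only [Set.mem_ofPred_eq, lt_top_iff_ne_top, ENat.ne_top_iff_exists, Set.mem_iUnion,
          eq_comm]
      rw [this]
      exact MeasurableSet.iUnion fun k => alg.isStoppingTime_τ.measurableSet_eq_of_countable' k
    exact h1.inter (alg.measurable_decision (Set.toFinite P).measurableSet)
  set E := {x | alg.τ x < ⊤ ∧ alg.decision x ∈ M.epsOptimal γ ε}
  have hle := alg.isStoppingTime_τ.measurableSpace_le
  have h1 : 1 - δ ≤ (alg.law M).real E :=
    (ENNReal.ofReal_le_iff_le_toReal (measure_ne_top _ _)).1 (hPAC M hM)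
  have h2 : (alg.law M').real E ≤ δ := by
    have h3 : 1 - δ ≤ (alg.law M').real {x | alg.τ x < ⊤ ∧ alg.decision x ∈ M'.epsOptimal γ ε} :=
      (ENNReal.ofReal_le_iff_le_toReal (measure_ne_top _ _)).1 (hPAC M' hM'l)
    have hd : Disjoint E {x | alg.τ x < ⊤ ∧ alg.decision x ∈ M'.epsOptimal γ ε} :=
      Set.disjoint_left.2 fun x hx hx' => (Set.ext_iff.1 hdisj _).1 ⟨hx.2, hx'.2⟩
    have h4 := measureReal_union (μ := alg.law M') hd (hle _ (hE _))
    have h5 : (alg.law M').real (E ∪ {x | alg.τ x < ⊤ ∧ alg.decision x ∈ M'.epsOptimal γ ε}) ≤ 1 :=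
      measureReal_le_one
    linarith
  -- The horizon can be removed because `τ` is finite on `E` and the sum of expected counts does not
  -- depend on `n`.
  have hlim : Filter.Tendsto (fun n : ℕ => (alg.law M).real (E ∩ {x | alg.τ x ≤ (n : ℕ∞)}))
      Filter.atTop (nhds ((alg.law M).real E)) := by
    have hmono : Monotone fun n : ℕ => E ∩ {x | alg.τ x ≤ (n : ℕ∞)} := fun i j hij x hx =>
      ⟨hx.1, le_trans (show alg.τ x ≤ (i : ℕ∞) from hx.2) (by exact_mod_cast hij)⟩
    have hU : ⋃ n : ℕ, E ∩ {x | alg.τ x ≤ (n : ℕ∞)} = E := by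
      rw [← Set.inter_iUnion]
      refine Set.inter_eq_left.2 fun x hx => ?_
      obtain ⟨k, hk⟩ := ENat.ne_top_iff_exists.1 hx.1.ne
      exact Set.mem_iUnion.2 ⟨k, hk.ge⟩
    have := tendsto_measure_iUnion_atTop (μ := alg.law M) hmono
    rw [hU] at this
    exact (ENNReal.tendsto_toReal (measure_ne_top _ _)).comp this
  have hlog : 0 ≤ Real.log ((1 - δ) / δ) :=
    Real.log_nonneg ((one_le_div₀ hδ₀).2 (by linarith))
  rw [kl_self_one_sub hδ₀ hδ₁]
  calc ENNReal.ofReal ((2 * (1 - δ) - 1) * Real.log ((1 - δ) / δ))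
      ≤ ENNReal.ofReal ((2 * (alg.law M).real E - 1) * Real.log ((1 - δ) / δ)) := by gcongr
    _ ≤ _ := le_of_tendsto
        (ENNReal.tendsto_ofReal (((hlim.const_mul 2).sub_const 1).mul_const _))
        (Filter.Eventually.of_forall fun n =>
          alg.test_le_sum_expectedCount hac (hE _) hδ₀ hδ₁ h2 n)

end Algorithm

end LinMDP

/-! ### From expected counts to the characteristic time -/

theorem mainTheorem6 {S A U : Type u} [Fintype S] [Fintype A] [Nonempty S] [Nonempty A]
    [MeasurableSpace S] [DiscreteMeasurableSpace S]
    [MeasurableSpace A] [DiscreteMeasurableSpace A] [MeasurableSpace U]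
    {d : ℕ} (φ : S → A → EuclideanSpace ℝ (Fin d))
    (hφ_norm : ∀ s a, ‖φ s a‖ ≤ 1)
    (hφ_span : Submodule.span ℝ {v | ∃ s a, φ s a = v} = ⊤)
    (ν : Measure ℝ) (hν : ν (Set.Icc (0 : ℝ) 1)ᶜ = 0)
    (γ : ℝ) (hγ₀ : 0 < γ) (hγ₁ : γ < 1)
    (ε : ℝ) (hε₀ : 0 ≤ ε) (hε₁ : ε < 1)
    (δ : ℝ) (hδ₀ : 0 < δ) (hδ₁ : δ ≤ 1 / 2)
    (alg : Algorithm S A U) (hPAC : alg.IsPAC φ ν γ ε δ)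
    (M : MDP S A) (hM : M ∈ linearMDPs φ ν γ) :
    charTime φ ν γ ε M * kl δ (1 - δ) ≤ alg.expectedTime M := by
  classical
  have hkl := fun M' (hM' : M' ∈ altMDPs φ ν γ ε M) =>
    Algorithm.kl_le_sum_expectedCount hδ₀ hδ₁ hPAC hM hM'
  have hsum := alg.sum_expectedCount M
  by_cases htop : alg.expectedTime M = ∞
  · simp [htop]
  set w := alg.expectedCount M
  set T := alg.expectedTime M
  have hwT : ∀ z, w z ≤ T := fun z =>
    hsum ▸ Finset.single_le_sum (f := w) (fun _ _ => zero_le) (Finset.mem_univ z)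
  obtain ⟨ω, hω, hωw⟩ : ∃ ω ∈ stdSimplex ℝ (S × A), ∀ z, w z = T * ENNReal.ofReal (ω z) := by
    by_cases h0 : T = 0
    · obtain ⟨z₀⟩ : Nonempty (S × A) := inferInstance
      refine ⟨Pi.single z₀ 1, single_mem_stdSimplex ℝ z₀, fun z => ?_⟩
      rw [h0, zero_mul]
      exact le_antisymm (h0 ▸ hwT z) zero_le
    · refine ⟨fun z => (w z / T).toReal, ⟨fun z => ENNReal.toReal_nonneg, ?_⟩, fun z => ?_⟩
      · rw [← ENNReal.toReal_sum fun z _ => ENNReal.div_ne_top (ne_top_of_le_ne_top htop (hwT z)) h0]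
        simp only [div_eq_mul_inv]
        rw [← Finset.sum_mul, hsum, ENNReal.mul_inv_cancel h0 htop, ENNReal.toReal_one]
      · rw [ENNReal.ofReal_toReal (ENNReal.div_ne_top (ne_top_of_le_ne_top htop (hwT z)) h0),
          ENNReal.mul_div_cancel h0 htop]
  have hle : invTime φ ν γ ε M ω ≤ ⨆ ω ∈ stdSimplex ℝ (S × A), invTime φ ν γ ε M ω :=
    le_iSup₂_of_le ω hω le_rfl
  rw [charTime]
  -- An empty alternative set is treated apart: the infimum is then `∞`, and `T * ∞` would be `0` at
  -- `T = 0`. There the characteristic time is `0`.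
  by_cases hne : (altMDPs φ ν γ ε M).Nonempty
  · have hT : kl δ (1 - δ) ≤ T * invTime φ ν γ ε M ω := by
      obtain ⟨M₀, hM₀⟩ := hne
      rw [invTime, iInf_subtype']
      have : Nonempty (altMDPs φ ν γ ε M) := ⟨⟨M₀, hM₀⟩⟩
      rw [ENNReal.mul_iInf fun h => absurd h htop]
      refine le_iInf fun M' => (hkl M' M'.2).trans_eq ?_
      rw [Finset.mul_sum]
      exact Finset.sum_congr rfl fun z _ => by rw [← mul_assoc, ← hωw z]
    set I := ⨆ ω ∈ stdSimplex ℝ (S × A), invTime φ ν γ ε M ω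
    calc I⁻¹ * kl δ (1 - δ) ≤ I⁻¹ * (T * I) := by gcongr; exact hT.trans (by gcongr)
      _ = (I⁻¹ * I) * T := by ring
      _ ≤ 1 * T := by gcongr; exact ENNReal.inv_mul_le_one I
      _ = T := one_mul T
  · have : invTime φ ν γ ε M ω = ∞ := by
      rw [Set.not_nonempty_iff_eq_empty] at hne
      simp [invTime, hne]
    rw [this, top_le_iff] at hle
    simp [hle]
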